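/- Let $A\in\mathbb{R}^{n\times n}$, $B\in\mathbb{R}^{n\times 1}$, $C\in\mathbb{R}^{n\times l}$, let $\chi(s)=C^T(sI_n-A)^{-1}B$, and consider $N$ agents $$\dot x_i=Ax_i+Bu_i,\qquad y_i=C^Tx_i,\qquad i=1,\dots,N,$$ placed at the vertices of a unit weighted digraph $\mathcal G$ on $\{1,\dots,N\}$ without self-loops. In an arc $(i,j)$ the vertex $j$ is a neighbour (parent) of $i$; $\mathcal N_i$ is the set of neighbours of $i$; $\mathcal A$ is the $0/1$ adjacency matrix ($\mathcal A_{ij}=1$ iff $(i,j)$ is an arc); and $L=\mathrm{diag}(\mathcal A\mathbf 1_N)-\mathcal A$ is the Laplace matrix. Assume: A1) $g\in\mathbb{R}^l$ is a vector such that $g^T\chi(s)$ is hyper-minimum-phase, i.e. in $g^T\chi(s)=b(s)/\det(sI_n-A)$ the numerator $b$ has degree $n-1$, positive coefficients, and all its roots in the open left half-plane. A2) $\mathcal G$ has a directed spanning tree, i.e. there are a vertex (the root) and a subset of the arcs with respect to which the root has no parent, every other vertex has exactly one parent, and there is a path from every vertex to the root. Let $$\varkappa_0=\sup_{\omega\in\mathbb{R}}\mathrm{Re}\Big(-\big(g^T\chi(\mathrm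 i\omega)\big)^{-1}\Big)$$ (where $(g^T\chi)^{-1}$ is taken to be $0$ at the poles of $g^T\chi$), and let $r(L)$ be the smallest real part of a nonzero eigenvalue of $L$ (if $N=1$ there is none, and $\varkappa_0/r(L)$ is read as $0$). Then $\varkappa_0<\infty$, and there is exactly one $v(L)\in\mathbb{R}^N$ with $v(L)^TL=0$ and $v(L)^T\mathbf 1_N=1$. For every gain $k>0$ with $k>\varkappa_0/r(L)$, every trajectory on $[0,\infty)$ of the network under the controller $$u_i(t)=-k\,g^T\bar y_i(t),\qquad \bar y_i(t)=\sum_{j\in\mathcal N_i}\big(y_i(t)-y_j(t)\big),\qquad i=1,\dots,N,$$ satisfies $\lim_{t\to\infty}(x_i(t)-x_j(t))=0$ for all $i,j$, and $\lim_{t\to\infty}(x_i(t)-c(t))=0$ for all $i$, where $$c(t)=\exp(At)\,(v(L)^T\otimes I_n)\,x(0),\qquad x=\mathrm{col}(x_1,\dots,x_N).$$ -/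

import Mathlib

open scoped Matrix Topology
open Filter

noncomputable section

namespace Consensus

/-- The transfer function `χ(s) = Cᵀ (s I - A)⁻¹ B` of the single-input system
`ẋ = A x + B u`, `y = Cᵀ x`, for complex `s`. -/
def transfer {n l : ℕ} (A : Matrix (Fin n) (Fin n) ℝ) (B : Fin n → ℝ)
    (C : Matrix (Fin n) (Fin l) ℝ) (s : ℂ) : Fin l → ℂ :=
  (C.map Complex.ofReal)ᵀ *ᵥ
    ((s • (1 : Matrix (Fin n) (Fin n) ℂ) - A.map Complex.ofReal)⁻¹ *ᵥ fun i => (B i : ℂ))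

/-- The scalar transfer function `gᵀ χ(s)`. -/
def scalarTransfer {n l : ℕ} (A : Matrix (Fin n) (Fin n) ℝ) (B : Fin n → ℝ)
    (C : Matrix (Fin n) (Fin l) ℝ) (g : Fin l → ℝ) (s : ℂ) : ℂ :=
  (fun i => (g i : ℂ)) ⬝ᵥ transfer A B C s

/-- `gᵀ χ(s)` is hyper-minimum-phase: written as `b(s) / det (s I - A)`, its numerator `b` has
degree `n - 1`, positive coefficients, and all its complex roots in the open left half-plane.
(`b` is unique, since the identity holds at all but finitely many `s`.) -/
def HyperMinimumPhase {n l : ℕ} (A : Matrix (Fin n) (Fin n) ℝ) (B : Fin n → ℝ)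
    (C : Matrix (Fin n) (Fin l) ℝ) (g : Fin l → ℝ) : Prop :=
  ∃ b : Polynomial ℝ,
    (∀ s : ℂ, Polynomial.aeval s A.charpoly ≠ 0 →
      scalarTransfer A B C g s = Polynomial.aeval s b / Polynomial.aeval s A.charpoly) ∧
    b.natDegree + 1 = n ∧
    (∀ i < n, 0 < b.coeff i) ∧
    ∀ z : ℂ, Polynomial.aeval z b = 0 → z.re < 0

/-- The function `ω ↦ Re (-(gᵀ χ(iω))⁻¹)`. When `gᵀ χ` is hyper-minimum-phase and `iω` is an
eigenvalue of `A`, it is a pole of `gᵀ χ`, so the value `0` produced here by the conventions for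
inverses is the limit value of `(gᵀ χ)⁻¹` at the pole. -/
def negReInv {n l : ℕ} (A : Matrix (Fin n) (Fin n) ℝ) (B : Fin n → ℝ)
    (C : Matrix (Fin n) (Fin l) ℝ) (g : Fin l → ℝ) (ω : ℝ) : ℝ :=
  (-(scalarTransfer A B C g (Complex.I * (ω : ℂ)))⁻¹).re

/-- `κ₀ = sup_ω Re (-(gᵀ χ(iω))⁻¹)`. -/
def kappa₀ {n l : ℕ} (A : Matrix (Fin n) (Fin n) ℝ) (B : Fin n → ℝ)
    (C : Matrix (Fin n) (Fin l) ℝ) (g : Fin l → ℝ) : ℝ :=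
  ⨆ ω : ℝ, negReInv A B C g ω

/-- `G` has a directed spanning tree `T` with root `r`. In an arc `(a, b)` the vertex `b` is the
parent of `a`: the root has no parent, every other vertex has exactly one, and in `T` there is a
path from every vertex to the root. -/
def HasDirectedSpanningTree {N : ℕ} (G : Digraph (Fin N)) : Prop :=
  ∃ (T : Digraph (Fin N)) (r : Fin N),
    (∀ a b, T.Adj a b → G.Adj a b) ∧
    (∀ b, ¬ T.Adj r b) ∧
    (∀ a, a ≠ r → ∃! b, T.Adj a b) ∧
    ∀ a, Relation.ReflTransGen T.Adj a r

open Classical in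
/-- Adjacency matrix of the unit weighted digraph. -/
def adjacency {N : ℕ} (G : Digraph (Fin N)) : Matrix (Fin N) (Fin N) ℝ :=
  Matrix.of fun i j => if G.Adj i j then 1 else 0

/-- Laplace matrix `L = diag(𝒜 1) - 𝒜`. -/
def laplacian {N : ℕ} (G : Digraph (Fin N)) : Matrix (Fin N) (Fin N) ℝ :=
  Matrix.diagonal (adjacency G *ᵥ 1) - adjacency G

/-- `r(L)`: the smallest real part of a nonzero complex eigenvalue of `L`. -/
def minNonzeroRe {N : ℕ} (L : Matrix (Fin N) (Fin N) ℝ) : ℝ :=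
  sInf {ρ : ℝ | ∃ μ ∈ spectrum ℂ (L.map Complex.ofReal), μ ≠ 0 ∧ μ.re = ρ}

/-- `v` is a left eigenvector of `L` for the eigenvalue `0` with `vᵀ 1 = 1`. -/
def IsNormalizedLeftNull {N : ℕ} (L : Matrix (Fin N) (Fin N) ℝ) (v : Fin N → ℝ) : Prop :=
  v ᵥ* L = 0 ∧ v ⬝ᵥ 1 = 1

open Classical in
/-- Relative outputs `ȳ_i = ∑_{j ∈ 𝒩_i} (y_i - y_j)`, where `𝒩_i` is the set of neighbours
of `i`, i.e. of the `j` such that `(i, j)` is an arc. -/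
def relOutput {N l : ℕ} (G : Digraph (Fin N)) (y : Fin N → Fin l → ℝ) (i : Fin N) : Fin l → ℝ :=
  ∑ j ∈ Finset.univ.filter (fun j => G.Adj i j), (y i - y j)

/-- `x = (x_1, …, x_N)` is a trajectory on `[0, ∞)` of the network `ẋ_i = A x_i + B u_i`,
`y_i = Cᵀ x_i`, under the controller `u_i = -k gᵀ ȳ_i`. -/
def IsClosedLoopTrajectory {N n l : ℕ} (A : Matrix (Fin n) (Fin n) ℝ) (B : Fin n → ℝ)
    (C : Matrix (Fin n) (Fin l) ℝ) (g : Fin l → ℝ) (G : Digraph (Fin N)) (k : ℝ)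
    (x : Fin N → ℝ → Fin n → ℝ) : Prop :=
  ∃ (y : Fin N → ℝ → Fin l → ℝ) (u : Fin N → ℝ → ℝ),
    ∀ i, ∀ t : ℝ, 0 ≤ t →
      y i t = Cᵀ *ᵥ x i t ∧
      u i t = -k * (g ⬝ᵥ relOutput G (fun j => y j t) i) ∧
      HasDerivWithinAt (x i) (A *ᵥ x i t + u i t • B) (Set.Ici 0) t

/-- The vector `c(t) = exp(A t) (vᵀ ⊗ I_n) x(0)`; here `(vᵀ ⊗ I_n) x(0) = ∑ i, v_i x_i(0)`. -/
def consensusVector {N n : ℕ} (A : Matrix (Fin n) (Fin n) ℝ) (v : Fin N → ℝ)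
    (x₀ : Fin N → Fin n → ℝ) (t : ℝ) : Fin n → ℝ :=
  NormedSpace.exp (t • A) *ᵥ ∑ i, v i • x₀ i

end Consensus

end

/-! Put h = Cg, z = ∑ v_j x_j and e_i = x_i - z. As vᵀL = 0, the coupling cancels in z, so z' = Az
and z = c; it remains to show e → 0.

The disagreement e obeys a linear equation with generator I ⊗ A - kL ⊗ Bhᵀ on the subspace of zero
weighted mean. `errorOperator` extends this generator to the whole space with the extra eigenvalue
-1 only. It commutes with L ⊗ I, so each of its eigenspaces contains a joint eigenvector, on which
it acts blockwise as A - kμBhᵀ with μ an eigenvalue of L; no triangularization of L is needed. For μ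
= 0 the joint eigenvector would be constant over the agents with zero mean, hence zero. For μ ≠ 0,
Gershgorin gives Re μ ≥ r(L) > 0, so c = kμ satisfies Re c > κ₀.

With a = det(s - A) one has det(s - A + cBhᵀ) = a + cb = b(a/b + c). On the imaginary axis Re(a/b +
c) ≥ Re c - κ₀ > 0 by definition of κ₀. Since a/b is s/β plus a bounded function, Phragmén–Lindelöf
carries this bound to the closed right half-plane (`le_re_div_add_of_le_re_imaginary_axis`), so A -
cBhᵀ has no eigenvalue there. -/

noncomputable section

namespace Consensus

/-! ### Rational functions in the right half-plane and the rank-one determinant identity. -/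

section HalfPlane

open Polynomial

/-- The distance from s to z is at least -Re z, which absorbs the constant 1 + ‖z‖ left by the
triangle inequality. -/
theorem one_add_norm_le_mul_norm_sub {z s : ℂ} (hz : z.re < 0) (hs : 0 ≤ s.re) :
    1 + ‖s‖ ≤ (1 + (1 + ‖z‖) / (-z.re)) * ‖s - z‖ := by
  have h1 : -z.re ≤ ‖s - z‖ := by
    have := Complex.re_le_norm (s - z)
    simp only [Complex.sub_re] at this
    linarith
  have h2 : ‖s‖ ≤ ‖s - z‖ + ‖z‖ := by simpa using norm_add_le (s - z) z
  have h3 : 1 + ‖z‖ ≤ (1 + ‖z‖) / (-z.re) * ‖s - z‖ := by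
    rw [div_mul_eq_mul_div, le_div_iff₀ (by linarith)]
    exact mul_le_mul_of_nonneg_left h1 (by positivity)
  linarith

theorem exists_pow_le_norm_multiset_prod (m : Multiset ℂ) (hm : ∀ z ∈ m, z.re < 0) :
    ∃ K : ℝ, 0 < K ∧ ∀ s : ℂ, 0 ≤ s.re →
      (1 + ‖s‖) ^ m.card ≤ K * ‖(m.map fun z => s - z).prod‖ := by
  induction m using Multiset.induction_on with
  | empty => exact ⟨1, one_pos, by simp⟩
  | cons z m ih =>
    obtain ⟨K, hK, h⟩ := ih fun w hw => hm w (Multiset.mem_cons_of_mem hw)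
    have hz := hm z (Multiset.mem_cons_self z m)
    have hz' : 0 < -z.re := by linarith
    refine ⟨(1 + (1 + ‖z‖) / (-z.re)) * K, by positivity, fun s hs => ?_⟩
    rw [Multiset.card_cons, pow_succ', Multiset.map_cons, Multiset.prod_cons, norm_mul]
    calc (1 + ‖s‖) * (1 + ‖s‖) ^ m.card
        ≤ ((1 + (1 + ‖z‖) / (-z.re)) * ‖s - z‖) * (K * ‖(m.map fun z => s - z).prod‖) :=
          mul_le_mul (one_add_norm_le_mul_norm_sub hz hs) (h s hs) (by positivity) (by positivity)
      _ = _ := by ring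

/-- A polynomial with all its roots in the open left half-plane is bounded below, in the closed
right half-plane, by a multiple of `(1 + ‖s‖) ^ deg`. -/
theorem exists_pow_le_norm_eval (b : ℂ[X]) (hb : b ≠ 0) (hroots : ∀ z, b.IsRoot z → z.re < 0) :
    ∃ K : ℝ, 0 < K ∧ ∀ s : ℂ, 0 ≤ s.re → (1 + ‖s‖) ^ b.natDegree ≤ K * ‖b.eval s‖ := by
  have hsplit := IsAlgClosed.splits b
  obtain ⟨K, hK, h⟩ := exists_pow_le_norm_multiset_prod b.roots
    fun z hz => hroots z ((mem_roots hb).1 hz)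
  have hl : 0 < ‖b.leadingCoeff‖ := norm_pos_iff.2 (leadingCoeff_ne_zero.2 hb)
  refine ⟨K / ‖b.leadingCoeff‖, by positivity, fun s hs => ?_⟩
  have hev : b.eval s = b.leadingCoeff * (b.roots.map fun z => s - z).prod := by
    conv_lhs => rw [hsplit.eq_prod_roots]
    simp [eval_multiset_prod, Multiset.map_map]
  rw [hev, norm_mul, ← mul_assoc, div_mul_cancel₀ _ hl.ne', hsplit.natDegree_eq_card_roots]
  exact h s hs

theorem exists_norm_eval_le_pow (q : ℂ[X]) {m : ℕ} (hq : q.natDegree ≤ m) :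
    ∃ M : ℝ, 0 ≤ M ∧ ∀ s : ℂ, ‖q.eval s‖ ≤ M * (1 + ‖s‖) ^ m := by
  refine ⟨∑ i ∈ Finset.range (m + 1), ‖q.coeff i‖, by positivity, fun s => ?_⟩
  rw [eval_eq_sum_range' (Nat.lt_succ_of_le hq), Finset.sum_mul]
  refine (norm_sum_le _ _).trans (Finset.sum_le_sum fun i hi => ?_)
  rw [norm_mul, norm_pow]
  refine mul_le_mul_of_nonneg_left ?_ (norm_nonneg _)
  calc ‖s‖ ^ i ≤ (1 + ‖s‖) ^ i := by gcongr; linarith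
    _ ≤ (1 + ‖s‖) ^ m := by
      apply pow_le_pow_right₀ (by linarith [norm_nonneg s])
      have := Finset.mem_range.1 hi
      omega

theorem exists_norm_div_le (q b : ℂ[X]) (hb : b ≠ 0) (hroots : ∀ z, b.IsRoot z → z.re < 0)
    (hq : q.natDegree ≤ b.natDegree) :
    ∃ M : ℝ, 0 ≤ M ∧ ∀ s : ℂ, 0 ≤ s.re → ‖q.eval s / b.eval s‖ ≤ M := by
  obtain ⟨K, hK, h1⟩ := exists_pow_le_norm_eval b hb hroots
  obtain ⟨M, hM, h2⟩ := exists_norm_eval_le_pow q hq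
  refine ⟨M * K, by positivity, fun s hs => ?_⟩
  have hbs : b.eval s ≠ 0 := fun h => absurd (hroots s h) (not_lt.2 hs)
  rw [norm_div, div_le_iff₀ (norm_pos_iff.2 hbs)]
  calc ‖q.eval s‖ ≤ M * (1 + ‖s‖) ^ b.natDegree := h2 s
    _ ≤ M * (K * ‖b.eval s‖) := mul_le_mul_of_nonneg_left (h1 s hs) hM
    _ = _ := by ring

/-- If `deg a = deg b + 1` and `b` has all its roots in the open left half-plane, then
`a / b` differs from a linear function by a bounded function in the closed right half-plane. -/
theorem exists_norm_div_sub_le (a b : ℂ[X]) (hb : b ≠ 0) (hroots : ∀ z, b.IsRoot z → z.re < 0)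
    (ha : a.Monic) (hab : a.natDegree = b.natDegree + 1) :
    ∃ M : ℝ, 0 ≤ M ∧ ∀ s : ℂ, 0 ≤ s.re →
      ‖a.eval s / b.eval s - s / b.leadingCoeff‖ ≤ M := by
  have hl : b.leadingCoeff ≠ 0 := leadingCoeff_ne_zero.2 hb
  -- Subtracting β⁻¹Xb, with β the leading coefficient of b, cancels the top term of a, so the
  -- remainder over b is proper.
  have hq : (a - C b.leadingCoeff⁻¹ * (X * b)).natDegree ≤ b.natDegree := by
    rw [natDegree_le_iff_coeff_eq_zero]
    intro i hi
    rcases Nat.lt_or_ge (b.natDegree + 1) i with h | h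
    · obtain ⟨j, rfl⟩ : ∃ j, i = j + 1 := ⟨i - 1, by omega⟩
      rw [coeff_sub, coeff_C_mul, coeff_X_mul, coeff_eq_zero_of_natDegree_lt (by omega),
        coeff_eq_zero_of_natDegree_lt (by omega)]
      simp
    · obtain rfl : i = b.natDegree + 1 := by omega
      rw [coeff_sub, coeff_C_mul, coeff_X_mul, ← hab, ha.coeff_natDegree, coeff_natDegree,
        inv_mul_cancel₀ hl, sub_self]
  obtain ⟨M, hM, h⟩ := exists_norm_div_le _ b hb hroots hq
  refine ⟨M, hM, fun s hs => ?_⟩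
  have hbs : b.eval s ≠ 0 := fun h => absurd (hroots s h) (not_lt.2 hs)
  convert h s hs using 2
  simp only [eval_sub, eval_mul, eval_C, eval_X]
  field_simp

/-- Half-plane minimum principle for the real part of an improper rational function with positive
leading coefficient. -/
theorem le_re_div_add_of_le_re_imaginary_axis (a b : ℂ[X])
    (hroots : ∀ z, b.IsRoot z → z.re < 0) (ha : a.Monic) (hab : a.natDegree = b.natDegree + 1)
    {β : ℝ} (hβ : 0 < β) (hbβ : b.leadingCoeff = β) (w : ℂ) {δ : ℝ}
    (haxis : ∀ ω : ℝ, δ ≤ (a.eval (Complex.I * ω) / b.eval (Complex.I * ω) + w).re)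
    {s : ℂ} (hs : 0 ≤ s.re) : δ ≤ (a.eval s / b.eval s + w).re := by
  have hb : b ≠ 0 := by
    rintro rfl
    simp only [leadingCoeff_zero] at hbβ
    exact hβ.ne (by exact_mod_cast hbβ)
  have hbs : ∀ s : ℂ, 0 ≤ s.re → b.eval s ≠ 0 :=
    fun s hs h => absurd (hroots s h) (not_lt.2 hs)
  obtain ⟨M, hM, hbound⟩ := exists_norm_div_sub_le a b hb hroots ha hab
  rw [hbβ] at hbound
  set F : ℂ → ℂ := fun s => a.eval s / b.eval s + w with hF
  have hFs : ∀ s : ℂ, 0 ≤ s.re → ‖F s - s / β‖ ≤ M + ‖w‖ := fun s hs => by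
    have : F s - s / β = (a.eval s / b.eval s - s / β) + w := by simp only [hF]; ring
    rw [this]
    exact (norm_add_le _ _).trans (by linarith [hbound s hs])
  have hdiff : ∀ s : ℂ, 0 ≤ s.re → DifferentiableAt ℂ (fun s => Complex.exp (-F s)) s :=
    fun s hs => (((a.differentiable s).div (b.differentiable s) (hbs s hs)).add_const w).neg.cexp
  have hclosure : closure {z : ℂ | 0 < z.re} = {z : ℂ | 0 ≤ z.re} := by
    simp
  -- Since ‖exp(-F)‖ = exp(-Re F), the lower bound for Re F becomes an upper bound. The estimate F =
  -- s/β + O(1) gives exponential growth of order 1 < 2 and decay along the positive reals.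
  have key := PhragmenLindelof.right_half_plane_of_tendsto_zero_on_real
    (f := fun s => Complex.exp (-F s)) (C := Real.exp (-δ)) (z := s) ?_ ?_ ?_ ?_ hs
  · rw [Complex.norm_exp, Real.exp_le_exp, Complex.neg_re] at key
    exact neg_le_neg_iff.1 key
  · refine DifferentiableOn.diffContOnCl fun z hz => ?_
    rw [hclosure] at hz
    exact (hdiff z hz).differentiableWithinAt
  · refine ⟨1, by norm_num, 1 / β, ?_⟩
    refine Asymptotics.IsBigO.of_bound (Real.exp (M + ‖w‖)) ?_
    refine (Filter.eventually_principal.2 fun z hz => ?_).filter_mono inf_le_right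
    rw [Complex.norm_exp, Real.rpow_one, Real.norm_of_nonneg (Real.exp_pos _).le, ← Real.exp_add,
      Real.exp_le_exp]
    have h1 := hFs z (le_of_lt hz)
    have h2 : ‖F z‖ ≤ ‖F z - z / β‖ + ‖z / β‖ := by
      simpa using norm_add_le (F z - z / β) (z / β)
    have h3 : ‖z / (β : ℂ)‖ = 1 / β * ‖z‖ := by
      rw [norm_div, Complex.norm_real, Real.norm_of_nonneg hβ.le]; ring
    have h4 := Complex.re_le_norm (-F z)
    rw [norm_neg] at h4
    linarith
  · rw [tendsto_zero_iff_norm_tendsto_zero]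
    have hlim : Tendsto (fun x : ℝ => Real.exp (-(x / β - (M + ‖w‖)))) atTop (𝓝 0) := by
      refine Real.tendsto_exp_neg_atTop_nhds_zero.comp ?_
      exact tendsto_atTop_add_const_right _ _ (tendsto_id.atTop_div_const hβ)
    refine squeeze_zero' (Eventually.of_forall fun _ => norm_nonneg _) ?_ hlim
    filter_upwards [eventually_ge_atTop 0] with x hx
    rw [Complex.norm_exp, Real.exp_le_exp, Complex.neg_re, neg_le_neg_iff]
    have h1 := (Complex.abs_re_le_norm _).trans (hFs (x : ℂ) (by simpa using hx))
    have h2 : ((x : ℂ) / β).re = x / β := by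
      rw [← Complex.ofReal_div, Complex.ofReal_re]
    rw [Complex.sub_re, h2, abs_le] at h1
    linarith [h1.1]
  · intro x
    rw [Complex.norm_exp, Real.exp_le_exp, Complex.neg_re, neg_le_neg_iff, mul_comm]
    exact haxis x

/-- The determinant of `s - A + c B hᵀ` is `a(s) + c b(s)`, where `a(s) = det (s - A)` and
`b / a` is the transfer function `hᵀ (s - A)⁻¹ B`. -/
theorem det_add_rank_one_eq {n : ℕ} (A : Matrix (Fin n) (Fin n) ℂ) (B h : Fin n → ℂ) (b : ℂ[X])
    (hb : ∀ s : ℂ, A.charpoly.eval s ≠ 0 →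
      h ⬝ᵥ ((s • (1 : Matrix (Fin n) (Fin n) ℂ) - A)⁻¹ *ᵥ B) = b.eval s / A.charpoly.eval s)
    (c s : ℂ) :
    (s • (1 : Matrix (Fin n) (Fin n) ℂ) - (A - c • Matrix.vecMulVec B h)).det
      = A.charpoly.eval s + c * b.eval s := by
  have hdet : ∀ (M : Matrix (Fin n) (Fin n) ℂ) (s : ℂ),
      (s • (1 : Matrix (Fin n) (Fin n) ℂ) - M).det = M.charpoly.eval s := fun M s => by
    rw [Matrix.eval_charpoly, Matrix.smul_one_eq_diagonal, Matrix.scalar_apply]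
  have hpoly : (A - c • Matrix.vecMulVec B h).charpoly = A.charpoly + C c * b := by
    -- Multiplying by the characteristic polynomial makes both sides vanish at the eigenvalues of A,
    -- where the formula for the transfer function is unavailable; elsewhere the matrix determinant
    -- lemma applies.
    refine mul_right_cancel₀ A.charpoly_monic.ne_zero (Polynomial.funext fun s => ?_)
    rw [eval_mul, eval_mul]
    by_cases hs : A.charpoly.eval s = 0
    · rw [hs, mul_zero, mul_zero]
    · congr 1
      have hu : IsUnit (s • (1 : Matrix (Fin n) (Fin n) ℂ) - A).det := by
        rw [hdet]; exact isUnit_iff_ne_zero.2 hs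
      have hrw : s • (1 : Matrix (Fin n) (Fin n) ℂ) - (A - c • Matrix.vecMulVec B h)
          = (s • (1 : Matrix (Fin n) (Fin n) ℂ) - A)
            + Matrix.replicateCol Unit (c • B) * Matrix.replicateRow Unit h := by
        ext i j
        simp [Matrix.mul_apply, Matrix.vecMulVec_apply]
        ring
      have hone : (Matrix.replicateRow Unit h * (s • (1 : Matrix (Fin n) (Fin n) ℂ) - A)⁻¹
          * Matrix.replicateCol Unit (c • B)) () ()
          = c * (h ⬝ᵥ ((s • (1 : Matrix (Fin n) (Fin n) ℂ) - A)⁻¹ *ᵥ B)) := by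
        rw [Matrix.mul_assoc, ← Matrix.replicateCol_mulVec, Matrix.mulVec_smul]
        simp [Matrix.mul_apply, dotProduct, Finset.mul_sum, mul_left_comm]
      rw [← hdet, hrw, Matrix.det_add_replicateCol_mul_replicateRow hu, hdet, Matrix.det_unique]
      rw [Matrix.add_apply, Matrix.one_apply_eq]
      erw [hone]
      rw [hb s hs, eval_add, eval_mul, eval_C]
      field_simp
  rw [hdet, hpoly, eval_add, eval_mul, eval_C]

end HalfPlane

/-! ### Kernel, left null vector and spectrum of the Laplace matrix. -/

section Graph

variable {N : ℕ}

theorem adjacency_nonneg (G : Digraph (Fin N)) (i j : Fin N) : 0 ≤ adjacency G i j := by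
  simp only [adjacency, Matrix.of_apply]
  split_ifs <;> norm_num

theorem laplacian_mulVec_apply (G : Digraph (Fin N)) (w : Fin N → ℝ) (i : Fin N) :
    (laplacian G *ᵥ w) i = ∑ j, adjacency G i j * (w i - w j) := by
  simp only [laplacian, Matrix.sub_mulVec, Pi.sub_apply, Matrix.mulVec_diagonal, mul_sub,
    Finset.sum_sub_distrib, ← Finset.sum_mul]
  simp [Matrix.mulVec, dotProduct]

theorem laplacian_mulVec_one (G : Digraph (Fin N)) : laplacian G *ᵥ 1 = 0 := by
  ext i
  simp [laplacian_mulVec_apply]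

theorem HasDirectedSpanningTree.exists_reachable {G : Digraph (Fin N)}
    (h : HasDirectedSpanningTree G) : ∃ r, ∀ a, Relation.ReflTransGen G.Adj a r := by
  obtain ⟨T, r, hT, -, -, hr⟩ := h
  exact ⟨r, fun a => Relation.ReflTransGen.mono hT _ _ (hr a)⟩

/-- A superharmonic function attaining its minimum at a vertex is constant along arcs from it. -/
theorem eq_of_adj_of_forall_le {G : Digraph (Fin N)} {w : Fin N → ℝ} {i j : Fin N}
    (hi : ∀ m, w i ≤ w m) (hL : 0 ≤ (laplacian G *ᵥ w) i) (hij : G.Adj i j) : w j = w i := by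
  rw [laplacian_mulVec_apply] at hL
  have hterm : ∀ m ∈ Finset.univ, adjacency G i m * (w i - w m) ≤ 0 := fun m _ =>
    mul_nonpos_of_nonneg_of_nonpos (adjacency_nonneg G i m) (by linarith [hi m])
  have hsum := le_antisymm (Finset.sum_nonpos hterm) hL
  have := (Finset.sum_eq_zero_iff_of_nonpos hterm).1 hsum j (Finset.mem_univ j)
  simp only [adjacency, Matrix.of_apply, if_pos hij, one_mul] at this
  linarith

/-- Minimum principle: the minimum value propagates along arcs, and the root is reachable from any
minimizer. Applied to w and -w it shows that the kernel of L consists of constants. -/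
theorem le_of_laplacian_mulVec_eq_zero {G : Digraph (Fin N)} {r : Fin N}
    (hr : ∀ a, Relation.ReflTransGen G.Adj a r) {w : Fin N → ℝ} (hL : laplacian G *ᵥ w = 0)
    (a : Fin N) : w r ≤ w a := by
  have : Nonempty (Fin N) := ⟨r⟩
  obtain ⟨i, hi⟩ := Finite.exists_min w
  have key : ∀ b, Relation.ReflTransGen G.Adj i b → w b = w i := fun b hb => by
    induction hb with
    | refl => rfl
    | tail _ hbc ih =>
      refine (eq_of_adj_of_forall_le (fun m => ih ▸ hi m) ?_ hbc).trans ih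
      rw [hL]; rfl
  exact (key r (hr i)).trans_le (hi a)

theorem eq_of_laplacian_mulVec_eq_zero {G : Digraph (Fin N)} {r : Fin N}
    (hr : ∀ a, Relation.ReflTransGen G.Adj a r) {w : Fin N → ℝ} (hL : laplacian G *ᵥ w = 0)
    (a : Fin N) : w a = w r := by
  refine le_antisymm ?_ (le_of_laplacian_mulVec_eq_zero hr hL a)
  have := le_of_laplacian_mulVec_eq_zero hr (w := -w) (by rw [Matrix.mulVec_neg, hL, neg_zero]) a
  simpa using this

theorem eq_of_complex_laplacian_mulVec_eq_zero {G : Digraph (Fin N)} {r : Fin N}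
    (hr : ∀ a, Relation.ReflTransGen G.Adj a r) {w : Fin N → ℂ}
    (hL : ∀ i, ∑ j, (laplacian G i j : ℂ) * w j = 0) (a : Fin N) : w a = w r := by
  refine Complex.ext ?_ ?_
  · refine eq_of_laplacian_mulVec_eq_zero hr (w := fun i => (w i).re) (funext fun i => ?_) a
    simpa [Matrix.mulVec, dotProduct] using congrArg Complex.re (hL i)
  · refine eq_of_laplacian_mulVec_eq_zero hr (w := fun i => (w i).im) (funext fun i => ?_) a
    simpa [Matrix.mulVec, dotProduct] using congrArg Complex.im (hL i)

/-- At a minimizer of w the entry of Lw is nonpositive. Hence 1 is not in the range of L, so range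
and kernel are complementary once the kernel is spanned by 1. -/
theorem laplacian_mulVec_ne_one [Nonempty (Fin N)] (G : Digraph (Fin N)) (w : Fin N → ℝ) :
    laplacian G *ᵥ w ≠ 1 := fun h => by
  obtain ⟨i, hi⟩ := Finite.exists_min w
  have h1 := congrFun h i
  rw [laplacian_mulVec_apply] at h1
  have : ∑ m, adjacency G i m * (w i - w m) ≤ 0 := Finset.sum_nonpos fun m _ =>
    mul_nonpos_of_nonneg_of_nonpos (adjacency_nonneg G i m) (by linarith [hi m])
  simp only [Pi.one_apply] at h1
  linarith

/-- The left null vector of the Laplace matrix normalized by `vᵀ 1 = 1` exists and is unique. -/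
theorem existsUnique_isNormalizedLeftNull {G : Digraph (Fin N)}
    (hG : HasDirectedSpanningTree G) : ∃! v, IsNormalizedLeftNull (laplacian G) v := by
  obtain ⟨r, hr⟩ := hG.exists_reachable
  have : Nonempty (Fin N) := ⟨r⟩
  set L := laplacian G
  have hone : (1 : Fin N → ℝ) ∉ LinearMap.range L.mulVecLin := by
    rintro ⟨w, hw⟩
    exact laplacian_mulVec_ne_one G w hw
  have hcompl : ∀ x : Fin N → ℝ, ∃ c : ℝ, ∃ w, x = L *ᵥ w + c • 1 := by
    have hker : LinearMap.ker L.mulVecLin = Submodule.span ℝ {(1 : Fin N → ℝ)} := by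
      refine le_antisymm (fun w hw => ?_) ?_
      · refine Submodule.mem_span_singleton.2 ⟨w r, funext fun a => ?_⟩
        simpa using (eq_of_laplacian_mulVec_eq_zero hr (LinearMap.mem_ker.1 hw) a).symm
      · rw [Submodule.span_singleton_le_iff_mem]
        exact laplacian_mulVec_one G
    have hdisj : LinearMap.range L.mulVecLin ⊓ Submodule.span ℝ {(1 : Fin N → ℝ)} = ⊥ := by
      rw [eq_bot_iff]
      rintro x ⟨hx1, hx2⟩
      obtain ⟨c, rfl⟩ := Submodule.mem_span_singleton.1 hx2
      by_cases hc : c = 0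
      · simp [hc]
      · refine absurd ?_ hone
        have := Submodule.smul_mem _ c⁻¹ hx1
        rwa [smul_smul, inv_mul_cancel₀ hc, one_smul] at this
    have hsup : LinearMap.range L.mulVecLin ⊔ Submodule.span ℝ {(1 : Fin N → ℝ)} = ⊤ := by
      apply Submodule.eq_top_of_finrank_eq
      have h1 := Submodule.finrank_sup_add_finrank_inf_eq (LinearMap.range L.mulVecLin)
        (Submodule.span ℝ {(1 : Fin N → ℝ)})
      have h2 := LinearMap.finrank_range_add_finrank_ker L.mulVecLin
      rw [hdisj, finrank_bot] at h1
      rw [hker] at h2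
      omega
    intro x
    obtain ⟨y, ⟨w, rfl⟩, z, hz, hyz⟩ := Submodule.mem_sup.1
      (show x ∈ LinearMap.range L.mulVecLin ⊔ Submodule.span ℝ {(1 : Fin N → ℝ)} by
        rw [hsup]; trivial)
    obtain ⟨c, rfl⟩ := Submodule.mem_span_singleton.1 hz
    exact ⟨c, w, hyz.symm⟩
  -- A functional that vanishes on the range of L but not at 1 is, after scaling, the left null
  -- vector; uniqueness holds because the range and 1 together span the space.
  obtain ⟨f, hf1, hf2⟩ := Submodule.exists_le_ker_of_notMem hone
  refine existsUnique_of_exists_of_unique ⟨fun i => f (Pi.single i 1) / f 1, ?_, ?_⟩ ?_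
  · ext j
    have hcol : f (L *ᵥ Pi.single j 1) = 0 := hf2 ⟨_, rfl⟩
    have hx : ∀ x : Fin N → ℝ, f x = ∑ i, x i * f (Pi.single i 1) := fun x => by
      conv_lhs => rw [← Finset.univ_sum_single x, map_sum]
      refine Finset.sum_congr rfl fun i _ => ?_
      rw [← smul_eq_mul, ← map_smul, ← Pi.single_smul, smul_eq_mul, mul_one]
    rw [hx] at hcol
    simp only [Matrix.vecMul, dotProduct, Pi.zero_apply]
    calc ∑ i, f (Pi.single i 1) / f 1 * L i j
        = (∑ i, (L *ᵥ Pi.single j 1) i * f (Pi.single i 1)) / f 1 := by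
          rw [Finset.sum_div]
          refine Finset.sum_congr rfl fun i _ => ?_
          simp [Matrix.mulVec_single]
          ring
      _ = 0 := by rw [hcol, zero_div]
  · simp only [dotProduct, Pi.one_apply, mul_one, ← Finset.sum_div, ← map_sum]
    rw [show ∑ i : Fin N, Pi.single i (1 : ℝ) = (1 : Fin N → ℝ) from Finset.univ_sum_single 1]
    exact div_self hf1
  · intro u v hu hv
    refine dotProduct_eq _ _ fun x => ?_
    obtain ⟨c, w, rfl⟩ := hcompl x
    simp only [dotProduct_add, dotProduct_smul, Matrix.dotProduct_mulVec, hu.1, hu.2, hv.1, hv.2]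

/-- Gershgorin: without loops each disc has centre and radius both equal to the out-degree d, so it
meets the closed left half-plane only at 0. -/
theorem re_pos_of_mem_spectrum_laplacian {G : Digraph (Fin N)} (hloop : ∀ i, ¬ G.Adj i i) {μ : ℂ}
    (hμ : μ ∈ spectrum ℂ ((laplacian G).map Complex.ofReal)) (h0 : μ ≠ 0) : 0 < μ.re := by
  rw [← Matrix.spectrum_toLin', ← Module.End.hasEigenvalue_iff_mem_spectrum] at hμ
  obtain ⟨i, hi⟩ := eigenvalue_mem_ball hμ
  have hdiag : adjacency G i i = 0 := by simp [adjacency, hloop i]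
  have hd : laplacian G i i = ∑ j, adjacency G i j := by
    simp [laplacian, hdiag, Matrix.mulVec, dotProduct]
  have hoff : ∑ j ∈ Finset.univ.erase i, ‖((laplacian G).map Complex.ofReal) i j‖
      = laplacian G i i := by
    rw [hd, ← Finset.add_sum_erase _ _ (Finset.mem_univ i), hdiag, zero_add]
    refine Finset.sum_congr rfl fun j hj => ?_
    have hij : i ≠ j := (Finset.ne_of_mem_erase hj).symm
    rw [Matrix.map_apply, Complex.norm_real, laplacian, Matrix.sub_apply,
      Matrix.diagonal_apply_ne _ hij, zero_sub, norm_neg,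
      Real.norm_of_nonneg (adjacency_nonneg G i j)]
  rw [hoff, Metric.mem_closedBall, dist_eq_norm, Matrix.map_apply] at hi
  set d := laplacian G i i
  have hsq : (μ.re - d) ^ 2 + μ.im ^ 2 ≤ d ^ 2 := by
    have h1 := pow_le_pow_left₀ (norm_nonneg _) hi 2
    rw [Complex.sq_norm, Complex.normSq_apply] at h1
    simp at h1
    nlinarith
  have hd0 : 0 ≤ d := (norm_nonneg _).trans hi
  by_contra hneg
  push Not at hneg
  refine h0 (Complex.ext ?_ ?_) <;> simp only [Complex.zero_re, Complex.zero_im] <;>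
    nlinarith [sq_nonneg μ.im, sq_nonneg μ.re, mul_nonneg hd0 (neg_nonneg.2 hneg)]

theorem finite_re_nonzero_spectrum (L : Matrix (Fin N) (Fin N) ℝ) :
    {ρ : ℝ | ∃ μ ∈ spectrum ℂ (L.map Complex.ofReal), μ ≠ 0 ∧ μ.re = ρ}.Finite := by
  refine ((Matrix.finite_spectrum (L.map Complex.ofReal)).image Complex.re).subset ?_
  rintro ρ ⟨μ, hμ, -, rfl⟩
  exact ⟨μ, hμ, rfl⟩

theorem minNonzeroRe_le {L : Matrix (Fin N) (Fin N) ℝ} {μ : ℂ}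
    (hμ : μ ∈ spectrum ℂ (L.map Complex.ofReal)) (h0 : μ ≠ 0) : minNonzeroRe L ≤ μ.re :=
  csInf_le (finite_re_nonzero_spectrum L).bddBelow ⟨μ, hμ, h0, rfl⟩

theorem minNonzeroRe_laplacian_pos {G : Digraph (Fin N)} (hloop : ∀ i, ¬ G.Adj i i) {μ : ℂ}
    (hμ : μ ∈ spectrum ℂ ((laplacian G).map Complex.ofReal)) (h0 : μ ≠ 0) :
    0 < minNonzeroRe (laplacian G) := by
  obtain ⟨ν, hν, hν0, h⟩ := Set.Nonempty.csInf_mem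
    (show {ρ : ℝ | ∃ μ ∈ spectrum ℂ ((laplacian G).map Complex.ofReal), μ ≠ 0 ∧ μ.re = ρ}.Nonempty
      from ⟨_, μ, hμ, h0, rfl⟩) (finite_re_nonzero_spectrum _)
  rw [minNonzeroRe, ← h]
  exact re_pos_of_mem_spectrum_laplacian hloop hν hν0

end Graph

/-! ### Decay of linear differential equations from the location of the eigenvalues. -/

section Stability

variable {E : Type*} [NormedAddCommGroup E] [NormedSpace ℂ E]

/-- Variation-of-constants estimate for `y' = l y + w` with a bounded forcing term on `[T, ∞)`. -/
theorem norm_le_of_hasDerivWithinAt_smul_add {l : ℂ} (hl : l.re < 0) {y w : ℝ → E} {T ε : ℝ}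
    (hy : ∀ t, T ≤ t → HasDerivWithinAt y (l • y t + w t) (Set.Ici T) t)
    (hw : ∀ t, T ≤ t → ‖w t‖ ≤ ε) {t : ℝ} (ht : T ≤ t) :
    ‖y t‖ ≤ ‖y T‖ * Real.exp (l.re * (t - T)) + ε / (-l.re) := by
  have hε : 0 ≤ ε := (norm_nonneg _).trans (hw T le_rfl)
  have hl' : 0 < -l.re := by linarith
  have hexp : ∀ t : ℝ, HasDerivAt (fun t : ℝ => Complex.exp (-l * ((t - T : ℝ) : ℂ)))
      (Complex.exp (-l * ((t - T : ℝ) : ℂ)) * (-l)) t := fun t => by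
    have h1 : HasDerivAt (fun t : ℝ => ((t - T : ℝ) : ℂ)) 1 t := by
      simpa using ((hasDerivAt_id t).sub_const T).ofReal_comp
    simpa using (h1.const_mul (-l)).cexp
  have hnorm : ∀ t : ℝ, ‖Complex.exp (-l * ((t - T : ℝ) : ℂ))‖ = Real.exp (-l.re * (t - T)) :=
    fun t => by rw [Complex.norm_exp, Complex.re_mul_ofReal, Complex.neg_re]
  have hder : ∀ t, T ≤ t → HasDerivWithinAt
      (fun t : ℝ => Complex.exp (-l * ((t - T : ℝ) : ℂ)) • y t)
      (Complex.exp (-l * ((t - T : ℝ) : ℂ)) • w t) (Set.Ici T) t := fun t ht => by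
    have := (hexp t).hasDerivWithinAt.smul (hy t ht)
    refine this.congr_deriv ?_
    rw [smul_add, smul_smul, add_right_comm, ← add_smul]
    simp
  have hB : ∀ t : ℝ, HasDerivAt
      (fun t : ℝ => ‖y T‖ + ε / (-l.re) * (Real.exp (-l.re * (t - T)) - 1))
      (ε * Real.exp (-l.re * (t - T))) t := fun t => by
    have h1 : HasDerivAt (fun t : ℝ => -l.re * (t - T)) (-l.re) t := by
      simpa using ((hasDerivAt_id t).sub_const T).const_mul (-l.re)
    refine (((h1.exp.sub_const 1).const_mul (ε / (-l.re))).const_add ‖y T‖).congr_deriv ?_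
    rw [mul_comm (Real.exp _), ← mul_assoc, div_mul_cancel₀ _ hl'.ne']
  -- After multiplication by the integrating factor exp(-l(t - T)) only the forcing is left in the
  -- derivative; the majorant is ‖y T‖ plus the integral of ε exp(-Re l (t - T)).
  have key := image_norm_le_of_norm_deriv_right_le_deriv_boundary' (a := T) (b := t)
    (f := fun t : ℝ => Complex.exp (-l * ((t - T : ℝ) : ℂ)) • y t)
    (f' := fun t : ℝ => Complex.exp (-l * ((t - T : ℝ) : ℂ)) • w t)
    (B := fun t : ℝ => ‖y T‖ + ε / (-l.re) * (Real.exp (-l.re * (t - T)) - 1))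
    (B' := fun t : ℝ => ε * Real.exp (-l.re * (t - T)))
    (fun s hs => ((hder s hs.1).mono (fun _ h => h.1)).continuousWithinAt)
    (fun s hs => (hder s hs.1).mono (Set.Ici_subset_Ici.2 hs.1))
    (by simp)
    (fun s _ => (hB s).continuousAt.continuousWithinAt)
    (fun s _ => (hB s).hasDerivWithinAt)
    (fun s hs => by
      rw [norm_smul, hnorm, mul_comm]
      exact mul_le_mul_of_nonneg_right (hw s hs.1) (Real.exp_pos _).le)
    (Set.right_mem_Icc.2 ht)
  rw [norm_smul, hnorm] at key
  have hpos := Real.exp_pos (l.re * (t - T))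
  have hinv : Real.exp (l.re * (t - T)) * Real.exp (-l.re * (t - T)) = 1 := by
    rw [← Real.exp_add]; simp
  have hq : 0 ≤ ε / (-l.re) := by positivity
  calc ‖y t‖ = Real.exp (l.re * (t - T)) * (Real.exp (-l.re * (t - T)) * ‖y t‖) := by
        rw [← mul_assoc, hinv, one_mul]
    _ ≤ Real.exp (l.re * (t - T))
        * (‖y T‖ + ε / (-l.re) * (Real.exp (-l.re * (t - T)) - 1)) :=
        mul_le_mul_of_nonneg_left key hpos.le
    _ = ‖y T‖ * Real.exp (l.re * (t - T)) + ε / (-l.re)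
          * (Real.exp (l.re * (t - T)) * Real.exp (-l.re * (t - T)))
          - ε / (-l.re) * Real.exp (l.re * (t - T)) := by ring
    _ ≤ _ := by rw [hinv, mul_one]; linarith [mul_nonneg hq hpos.le]

theorem tendsto_zero_of_hasDerivWithinAt_smul_add {l : ℂ} (hl : l.re < 0) {y w : ℝ → E}
    (hy : ∀ t, 0 ≤ t → HasDerivWithinAt y (l • y t + w t) (Set.Ici 0) t)
    (hw : Tendsto w atTop (𝓝 0)) : Tendsto y atTop (𝓝 0) := by
  have hl' : 0 < -l.re := by linarith
  rw [NormedAddGroup.tendsto_nhds_zero]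
  intro ε hε
  -- This threshold makes the forcing after T contribute at most ε/2; the transient from T takes the
  -- other half.
  have hw' := NormedAddGroup.tendsto_nhds_zero.1 hw (ε / 2 * (-l.re)) (by positivity)
  obtain ⟨T, hT⟩ := eventually_atTop.1 (hw'.and (eventually_ge_atTop 0))
  have hT0 : 0 ≤ T := (hT T le_rfl).2
  have hlim : Tendsto (fun t : ℝ => ‖y T‖ * Real.exp (l.re * (t - T))) atTop (𝓝 0) := by
    rw [← mul_zero ‖y T‖]
    refine Tendsto.const_mul _ (Real.tendsto_exp_atBot.comp ?_)
    exact (tendsto_atTop_add_const_right _ (-T) tendsto_id).const_mul_atTop_of_neg hl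
  filter_upwards [hlim.eventually (gt_mem_nhds (half_pos hε)), eventually_ge_atTop T] with t h1 h2
  have := norm_le_of_hasDerivWithinAt_smul_add hl (T := T)
    (fun s hs => (hy s (hT0.trans hs)).mono (Set.Ici_subset_Ici.2 hT0))
    (fun s hs => (hT s hs).1.le) h2
  rw [mul_div_cancel_right₀ _ hl'.ne'] at this
  linarith

/-- Peel off one factor: (M - l)y solves the same equation and is annihilated by the remaining
factors, so it tends to 0 by induction. It is then the forcing term in y' = ly + (M - l)y. -/
theorem tendsto_zero_of_multiset_prod_apply_eq_zero (M : E →L[ℂ] E) (m : Multiset ℂ)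
    (hm : ∀ l ∈ m, l.re < 0) (y : ℝ → E)
    (hy : ∀ t, 0 ≤ t → HasDerivWithinAt y (M (y t)) (Set.Ici 0) t)
    (h0 : ∀ t, 0 ≤ t → Polynomial.aeval (M : Module.End ℂ E)
      (m.map fun l => Polynomial.X - Polynomial.C l).prod (y t) = 0) :
    Tendsto y atTop (𝓝 0) := by
  induction m using Multiset.induction_on generalizing y with
  | empty =>
    refine tendsto_const_nhds.congr' ?_
    filter_upwards [eventually_ge_atTop 0] with t ht
    simpa using (h0 t ht).symm
  | cons l m ih =>
    have hw : Tendsto (fun t => M (y t) - l • y t) atTop (𝓝 0) := by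
      refine ih (fun k hk => hm k (Multiset.mem_cons_of_mem hk)) _ (fun t ht => ?_)
        fun t ht => ?_
      · have h1 := (M.restrictScalars ℝ).hasFDerivAt.comp_hasDerivWithinAt t (hy t ht)
        have := h1.sub ((hy t ht).const_smul l)
        rw [map_sub, map_smul]
        exact this
      · have := h0 t ht
        rw [Multiset.map_cons, Multiset.prod_cons, mul_comm, map_mul] at this
        simpa [Module.algebraMap_end_apply] using this
    refine tendsto_zero_of_hasDerivWithinAt_smul_add (hm l (Multiset.mem_cons_self l m))
      (fun t ht => ?_) hw
    simpa using hy t ht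

/-- Solutions of `y' = M y` on `[0, ∞)` tend to zero when all eigenvalues of `M` have negative
real parts. -/
theorem tendsto_zero_of_eigenvalues_re_neg [FiniteDimensional ℂ E] (M : E →L[ℂ] E)
    (hM : ∀ l : ℂ, Module.End.HasEigenvalue (M : Module.End ℂ E) l → l.re < 0) {y : ℝ → E}
    (hy : ∀ t, 0 ≤ t → HasDerivWithinAt y (M (y t)) (Set.Ici 0) t) :
    Tendsto y atTop (𝓝 0) := by
  -- The minimal polynomial annihilates every state, and its roots are the eigenvalues of M.
  set p := minpoly ℂ (M : Module.End ℂ E) with hp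
  have hint : IsIntegral ℂ (M : Module.End ℂ E) := Algebra.IsIntegral.isIntegral _
  refine tendsto_zero_of_multiset_prod_apply_eq_zero M p.roots (fun l hl => hM l ?_) y hy
    fun t _ => ?_
  · rw [Module.End.hasEigenvalue_iff_isRoot]
    exact Polynomial.isRoot_of_mem_roots hl
  · have h1 : p = (p.roots.map fun l => Polynomial.X - Polynomial.C l).prod := by
      have := (IsAlgClosed.splits p).eq_prod_roots
      rwa [(minpoly.monic hint).leadingCoeff, Polynomial.C_1, one_mul] at this
    rw [← h1, hp, minpoly.aeval]
    rfl

end Stability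

/-! ### Spectrum of the disagreement dynamics via joint eigenvectors with L ⊗ I. -/

section ErrorDynamics

variable {N n : ℕ}

/-- Action of `L ⊗ I` on families of state vectors. -/
def networkAction (L : Matrix (Fin N) (Fin N) ℂ) : Module.End ℂ (Fin N → Fin n → ℂ) where
  toFun e i := ∑ j, L i j • e j
  map_add' e f := by
    ext i a
    simp [Finset.sum_add_distrib]
  map_smul' c e := by
    ext i a
    simp [Finset.mul_sum, mul_left_comm]

/-- Generator of the disagreement dynamics: on the invariant subspace `∑ j, v j • e j = 0` it is
`I ⊗ A - k L ⊗ B hᵀ`, and on the complementary quotient it is `-1`. -/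
def errorOperator (A : Matrix (Fin n) (Fin n) ℂ) (B h : Fin n → ℂ)
    (L : Matrix (Fin N) (Fin N) ℂ) (v : Fin N → ℂ) (k : ℂ) :
    Module.End ℂ (Fin N → Fin n → ℂ) where
  toFun e i := A *ᵥ e i - (k * (h ⬝ᵥ ∑ j, L i j • e j)) • B - (A + 1) *ᵥ ∑ j, v j • e j
  map_add' e f := by
    ext1 i
    simp only [Pi.add_apply, smul_add, Finset.sum_add_distrib, Matrix.mulVec_add, dotProduct_add]
    module
  map_smul' c e := by
    ext1 i
    simp only [Pi.smul_apply, RingHom.id_apply, smul_comm _ c, ← Finset.smul_sum,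
      Matrix.mulVec_smul, dotProduct_smul, smul_eq_mul]
    module

variable {A : Matrix (Fin n) (Fin n) ℂ} {B h : Fin n → ℂ} {L : Matrix (Fin N) (Fin N) ℂ}
  {v : Fin N → ℂ} {k : ℂ}

theorem networkAction_apply (e : Fin N → Fin n → ℂ) (i : Fin N) :
    networkAction L e i = ∑ j, L i j • e j := rfl

theorem errorOperator_apply (e : Fin N → Fin n → ℂ) (i : Fin N) :
    errorOperator A B h L v k e i
      = A *ᵥ e i - (k * (h ⬝ᵥ networkAction L e i)) • B - (A + 1) *ᵥ ∑ j, v j • e j := rfl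

theorem sum_smul_networkAction (hv : v ᵥ* L = 0) (e : Fin N → Fin n → ℂ) :
    ∑ i, v i • networkAction L e i = 0 := by
  simp only [networkAction_apply, Finset.smul_sum, smul_smul]
  rw [Finset.sum_comm]
  refine Finset.sum_eq_zero fun j _ => ?_
  rw [← Finset.sum_smul]
  have : ∑ i, v i * L i j = 0 := congrFun hv j
  rw [this, zero_smul]

/-- The correction term is the same for all agents, so zero row sums of L kill it on one side, and
vᵀL = 0 kills it on the other. -/
theorem commute_networkAction_errorOperator (hv : v ᵥ* L = 0) (hL : L *ᵥ 1 = 0) :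
    Commute (networkAction L) (errorOperator A B h L v k) := by
  refine LinearMap.ext fun e => funext fun i => ?_
  have hrow : ∑ j, L i j = 0 := by simpa [Matrix.mulVec, dotProduct] using congrFun hL i
  rw [Module.End.mul_apply, Module.End.mul_apply, errorOperator_apply,
    sum_smul_networkAction hv, Matrix.mulVec_zero, sub_zero, networkAction_apply]
  simp only [errorOperator_apply, smul_sub, Finset.sum_sub_distrib, ← Finset.sum_smul, hrow,
    zero_smul, sub_zero]
  congr 1
  · rw [networkAction_apply, Matrix.mulVec_sum]
    simp only [Matrix.mulVec_smul]
  · rw [networkAction_apply (networkAction L e), dotProduct_sum, Finset.mul_sum, Finset.sum_smul]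
    refine Finset.sum_congr rfl fun j _ => ?_
    rw [smul_smul, dotProduct_smul, smul_eq_mul, mul_left_comm]

theorem sum_smul_errorOperator (hv : v ᵥ* L = 0) (hv1 : ∑ i, v i = 1)
    (e : Fin N → Fin n → ℂ) :
    ∑ i, v i • errorOperator A B h L v k e i = -∑ i, v i • e i := by
  have h1 : ∑ i, v i • A *ᵥ e i = A *ᵥ ∑ i, v i • e i := by
    rw [Matrix.mulVec_sum]
    simp only [Matrix.mulVec_smul]
  have h2 : ∑ i, v i • (k * (h ⬝ᵥ networkAction L e i)) • B = 0 := by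
    have : ∑ i, v i • (k * (h ⬝ᵥ networkAction L e i)) • B
        = (k * (h ⬝ᵥ ∑ i, v i • networkAction L e i)) • B := by
      rw [dotProduct_sum, Finset.mul_sum, Finset.sum_smul]
      refine Finset.sum_congr rfl fun j _ => ?_
      rw [smul_smul, dotProduct_smul, smul_eq_mul, mul_left_comm]
    rw [this, sum_smul_networkAction hv, dotProduct_zero, mul_zero, zero_smul]
  simp only [errorOperator_apply, smul_sub, Finset.sum_sub_distrib, ← Finset.sum_smul, hv1,
    one_smul, h1, h2, Matrix.add_mulVec, Matrix.one_mulVec]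
  abel

/-- The eigenvalues of the disagreement dynamics have negative real parts if those of
`A - k μ B hᵀ` do for all nonzero eigenvalues `μ` of `L`. -/
theorem re_neg_of_hasEigenvalue_errorOperator (hv : v ᵥ* L = 0) (hv1 : ∑ i, v i = 1)
    (hL : L *ᵥ 1 = 0) (hker : ∀ w : Fin N → ℂ, L *ᵥ w = 0 → ∀ i j, w i = w j)
    (hstab : ∀ μ ∈ spectrum ℂ L, μ ≠ 0 → ∀ l : ℂ, 0 ≤ l.re → ∀ ξ : Fin n → ℂ,
      A *ᵥ ξ - (k * (μ * (h ⬝ᵥ ξ))) • B = l • ξ → ξ = 0)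
    {l : ℂ} (hl : (errorOperator A B h L v k).HasEigenvalue l) : l.re < 0 := by
  by_contra hre
  push Not at hre
  set S := (errorOperator A B h L v k).eigenspace l with hS
  have : Nontrivial S := Submodule.nontrivial_iff_ne_bot.2 hl
  have hmaps : ∀ e ∈ S, networkAction L e ∈ S := fun e he => by
    rw [hS, Module.End.mem_eigenspace_iff] at he ⊢
    have hc := LinearMap.congr_fun
      (commute_networkAction_errorOperator (A := A) (B := B) (h := h) (k := k) hv hL).eq e
    rw [Module.End.mul_apply, Module.End.mul_apply] at hc
    rw [← hc, he, map_smul]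
  -- By commutation L ⊗ I preserves the eigenspace, so it has an eigenvector e inside it.
  obtain ⟨μ, hμ⟩ := Module.End.exists_eigenvalue ((networkAction L).restrict hmaps)
  obtain ⟨⟨e, heS⟩, he, hne⟩ := hμ.exists_hasEigenvector
  rw [Module.End.mem_eigenspace_iff] at he
  replace he : networkAction L e = μ • e := congrArg Subtype.val he
  replace hne : e ≠ 0 := fun h0 => hne (Subtype.ext h0)
  rw [hS, Module.End.mem_eigenspace_iff] at heS
  have hcol : ∀ a, L *ᵥ (fun i => e i a) = μ • fun i => e i a := fun a => by
    ext i
    have := congrFun (congrFun he i) a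
    simpa [networkAction_apply, Matrix.mulVec, dotProduct] using this
  -- The weighted mean of an eigenvector satisfies (l + 1)·mean = 0, and l ≠ -1 because Re l ≥ 0.
  have hmean : ∑ i, v i • e i = 0 := by
    have h1 := sum_smul_errorOperator (A := A) (B := B) (h := h) (k := k) hv hv1 e
    have h2 : ∑ i, v i • (l • e) i = l • ∑ i, v i • e i := by
      simp only [Pi.smul_apply, smul_comm _ l, ← Finset.smul_sum]
    rw [heS, h2] at h1
    have h3 : (l + 1) • ∑ i, v i • e i = 0 := by rw [add_smul, h1, one_smul, neg_add_cancel]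
    refine (smul_eq_zero.1 h3).resolve_left fun h0 => ?_
    have := congrArg Complex.re h0
    simp only [Complex.add_re, Complex.one_re, Complex.zero_re] at this
    linarith
  refine hne (funext fun i => ?_)
  by_cases hμ0 : μ = 0
  · ext a
    have hconst := hker (fun i => e i a) (by rw [hcol, hμ0, zero_smul])
    have h1 := congrFun hmean a
    simp only [Finset.sum_apply, Pi.smul_apply, smul_eq_mul] at h1
    rw [Finset.sum_congr rfl fun j _ => by rw [hconst j i], ← Finset.sum_mul, hv1, one_mul] at h1
    exact h1
  -- A nonzero coordinate slice of e, taken across the agents, is an eigenvector of L.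
  · have hspec : μ ∈ spectrum ℂ L := by
      obtain ⟨j, hj⟩ := Function.ne_iff.1 hne
      obtain ⟨a, ha⟩ := Function.ne_iff.1 hj
      rw [← Matrix.spectrum_toLin', ← Module.End.hasEigenvalue_iff_mem_spectrum]
      refine Module.End.hasEigenvalue_of_hasEigenvector (x := fun i => e i a) ⟨?_, ?_⟩
      · rw [Module.End.mem_eigenspace_iff, Matrix.toLin'_apply, hcol]
      · exact fun h0 => ha (congrFun h0 j)
    refine hstab μ hspec hμ0 l hre (e i) ?_
    have h1 := congrFun heS i
    rw [errorOperator_apply, hmean, Matrix.mulVec_zero, sub_zero, he] at h1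
    rwa [Pi.smul_apply, Pi.smul_apply, dotProduct_smul, smul_eq_mul] at h1

end ErrorDynamics

/-! ### From the hyper-minimum-phase condition to stability under complex feedback gains. -/

section TransferFunction

open Polynomial

variable {n l : ℕ} {A : Matrix (Fin n) (Fin n) ℝ} {B : Fin n → ℝ}
  {C : Matrix (Fin n) (Fin l) ℝ} {g : Fin l → ℝ}

theorem scalarTransfer_eq (s : ℂ) : scalarTransfer A B C g s
    = (fun i => ((C *ᵥ g) i : ℂ)) ⬝ᵥ ((s • (1 : Matrix (Fin n) (Fin n) ℂ)
      - A.map Complex.ofReal)⁻¹ *ᵥ fun i => (B i : ℂ)) := by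
  rw [scalarTransfer, transfer, Matrix.dotProduct_mulVec, Matrix.vecMul_transpose]
  congr 1
  ext i
  simp [Matrix.mulVec, dotProduct]

/-- Complex form of the hyper-minimum-phase condition, with the values of `negReInv` expressed by
the numerator and denominator polynomials, at the poles too. -/
theorem HyperMinimumPhase.exists_complex_numerator (hA : HyperMinimumPhase A B C g) :
    ∃ (b : ℂ[X]) (β : ℝ), 0 < β ∧ b.leadingCoeff = β ∧ (∀ z, b.IsRoot z → z.re < 0) ∧
      (A.map Complex.ofReal).charpoly.natDegree = b.natDegree + 1 ∧
      (∀ s : ℂ, (A.map Complex.ofReal).charpoly.eval s ≠ 0 → scalarTransfer A B C g s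
        = b.eval s / (A.map Complex.ofReal).charpoly.eval s) ∧
      ∀ ω : ℝ, negReInv A B C g ω = -((A.map Complex.ofReal).charpoly.eval (Complex.I * ω)
        / b.eval (Complex.I * ω)).re := by
  obtain ⟨b, htr, hdeg, hpos, hroots⟩ := hA
  have hchar : (A.map Complex.ofReal).charpoly = A.charpoly.map (algebraMap ℝ ℂ) :=
    Matrix.charpoly_map A (algebraMap ℝ ℂ)
  have heval : ∀ (p : ℝ[X]) (s : ℂ), aeval s p = (p.map (algebraMap ℝ ℂ)).eval s :=
    fun p s => by rw [aeval_def, eval_map]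
  simp only [heval, ← hchar] at htr hroots
  refine ⟨b.map (algebraMap ℝ ℂ), b.leadingCoeff, hpos _ (by omega), ?_, hroots, ?_, htr,
    fun ω => ?_⟩
  · exact leadingCoeff_map _
  · rw [Matrix.charpoly_natDegree_eq_dim, Fintype.card_fin, natDegree_map, hdeg]
  · rw [negReInv, Complex.neg_re]
    -- At an imaginary eigenvalue of A the singular resolvent has the default value 0, so the
    -- inverted transfer function is 0 as well, in agreement with a/b = 0.
    by_cases h0 : (A.map Complex.ofReal).charpoly.eval (Complex.I * ω) = 0
    · have hdet : ¬ IsUnit ((Complex.I * ω) • (1 : Matrix (Fin n) (Fin n) ℂ)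
          - A.map Complex.ofReal).det := by
        rw [Matrix.smul_one_eq_diagonal, ← Matrix.scalar_apply, ← Matrix.eval_charpoly, h0]
        exact not_isUnit_zero
      rw [scalarTransfer_eq, Matrix.nonsing_inv_apply_not_isUnit _ hdet, h0]
      simp
    · rw [htr _ h0, inv_div]

/-- On the imaginary axis the linear part s/β of a/b is purely imaginary, so only the bounded
remainder contributes to the real part. -/
theorem HyperMinimumPhase.bddAbove_range_negReInv (hA : HyperMinimumPhase A B C g) :
    BddAbove (Set.range (negReInv A B C g)) := by
  obtain ⟨b, β, hβ, hb, hroots, hdeg, -, hneg⟩ := hA.exists_complex_numerator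
  have hb0 : b ≠ 0 := by
    rintro rfl
    rw [leadingCoeff_zero] at hb
    exact hβ.ne (by exact_mod_cast hb)
  obtain ⟨M, -, hM⟩ := exists_norm_div_sub_le _ b hb0 hroots
    (Matrix.charpoly_monic (A.map Complex.ofReal)) hdeg
  refine ⟨M, ?_⟩
  rintro _ ⟨ω, rfl⟩
  have h1 := (Complex.abs_re_le_norm _).trans (hM (Complex.I * ω) (by simp))
  have h2 : (Complex.I * ω / b.leadingCoeff).re = 0 := by
    rw [hb, mul_div_assoc, ← Complex.ofReal_div, Complex.I_mul_re, Complex.ofReal_im, neg_zero]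
  rw [Complex.sub_re, h2, sub_zero, abs_le] at h1
  rw [hneg]
  linarith [h1.1]

/-- The complex output feedback `A - c B hᵀ` has no eigenvalue in the closed right half-plane when
`Re c > κ₀`. -/
theorem HyperMinimumPhase.eq_zero_of_eigenvector (hA : HyperMinimumPhase A B C g) {c : ℂ}
    (hc : kappa₀ A B C g < c.re) {s : ℂ} (hs : 0 ≤ s.re) {ξ : Fin n → ℂ}
    (hξ : A.map Complex.ofReal *ᵥ ξ - (c * ((fun i => ((C *ᵥ g) i : ℂ)) ⬝ᵥ ξ)) •
      (fun i => (B i : ℂ)) = s • ξ) : ξ = 0 := by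
  obtain ⟨b, β, hβ, hb, hroots, hdeg, htr, hneg⟩ := hA.exists_complex_numerator
  have haxis : ∀ ω : ℝ, c.re - kappa₀ A B C g
      ≤ ((A.map Complex.ofReal).charpoly.eval (Complex.I * ω) / b.eval (Complex.I * ω) + c).re :=
    fun ω => by
      have := le_ciSup hA.bddAbove_range_negReInv ω
      rw [hneg] at this
      rw [Complex.add_re, kappa₀]
      linarith
  have hpos := le_re_div_add_of_le_re_imaginary_axis _ b hroots
    (Matrix.charpoly_monic (A.map Complex.ofReal)) hdeg hβ hb c haxis hs
  have hbs : b.eval s ≠ 0 := fun h => absurd (hroots s h) (not_lt.2 hs)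
  have hdet := det_add_rank_one_eq (A.map Complex.ofReal) (fun i => (B i : ℂ))
    (fun i => ((C *ᵥ g) i : ℂ)) b (fun s hs => by rw [← scalarTransfer_eq, htr s hs]) c s
  refine Matrix.eq_zero_of_mulVec_eq_zero ?_ (M := s • (1 : Matrix (Fin n) (Fin n) ℂ)
    - (A.map Complex.ofReal - c • Matrix.vecMulVec (fun i => (B i : ℂ))
      (fun i => ((C *ᵥ g) i : ℂ)))) ?_
  · rw [hdet]
    intro h0
    have h1 : (A.map Complex.ofReal).charpoly.eval s / b.eval s + c = 0 := by
      rw [div_add' _ _ _ hbs, h0, zero_div]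
    rw [h1, Complex.zero_re] at hpos
    linarith
  · rw [Matrix.sub_mulVec, Matrix.sub_mulVec, Matrix.smul_mulVec, Matrix.one_mulVec,
      Matrix.smul_mulVec, Matrix.vecMulVec_mulVec, ← hξ]
    ext i
    simp
    ring

end TransferFunction

/-! ### The closed loop: weighted mean, disagreement and consensus. -/

section Network

variable {N n l : ℕ} {A : Matrix (Fin n) (Fin n) ℝ} {B : Fin n → ℝ}
  {C : Matrix (Fin n) (Fin l) ℝ} {g : Fin l → ℝ} {G : Digraph (Fin N)} {k : ℝ}
  {x : Fin N → ℝ → Fin n → ℝ}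

theorem relOutput_eq_sum (y : Fin N → Fin l → ℝ) (i : Fin N) :
    relOutput G y i = ∑ j, adjacency G i j • (y i - y j) := by
  classical
  rw [relOutput, Finset.sum_filter]
  refine Finset.sum_congr rfl fun j _ => ?_
  simp only [adjacency, Matrix.of_apply]
  split_ifs <;> simp

theorem IsClosedLoopTrajectory.hasDerivWithinAt (hx : IsClosedLoopTrajectory A B C g G k x)
    (i : Fin N) {t : ℝ} (ht : 0 ≤ t) :
    HasDerivWithinAt (x i)
      (A *ᵥ x i t - (k * ((C *ᵥ g) ⬝ᵥ ∑ j, laplacian G i j • x j t)) • B) (Set.Ici 0) t := by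
  obtain ⟨y, u, h⟩ := hx
  obtain ⟨-, hu, hd⟩ := h i t ht
  have hy : (fun j => y j t) = fun j => Cᵀ *ᵥ x j t := funext fun j => (h j t ht).1
  have hgy : ∀ w : Fin n → ℝ, g ⬝ᵥ Cᵀ *ᵥ w = (C *ᵥ g) ⬝ᵥ w := fun w => by
    rw [Matrix.dotProduct_mulVec, Matrix.vecMul_transpose]
  have hsum : g ⬝ᵥ relOutput G (fun j => y j t) i
      = (C *ᵥ g) ⬝ᵥ ∑ j, laplacian G i j • x j t := by
    have h1 := laplacian_mulVec_apply G (fun j => (C *ᵥ g) ⬝ᵥ x j t) i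
    rw [hy, relOutput_eq_sum, dotProduct_sum, dotProduct_sum]
    simp only [dotProduct_smul, dotProduct_sub, hgy, smul_eq_mul]
    exact h1.symm
  rw [hu, hsum, neg_mul, neg_smul, ← sub_eq_add_neg] at hd
  exact hd

theorem IsClosedLoopTrajectory.hasDerivWithinAt_mean (hx : IsClosedLoopTrajectory A B C g G k x)
    {v : Fin N → ℝ} (hv : v ᵥ* laplacian G = 0) {t : ℝ} (ht : 0 ≤ t) :
    HasDerivWithinAt (fun t => ∑ i, v i • x i t) (A *ᵥ ∑ i, v i • x i t) (Set.Ici 0) t := by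
  have h1 : HasDerivWithinAt (fun t => ∑ i, v i • x i t) _ (Set.Ici 0) t :=
    HasDerivWithinAt.fun_sum fun i _ => (hx.hasDerivWithinAt i ht).const_smul (v i)
  refine h1.congr_deriv ?_
  have h2 : ∑ i, v i • (k * ((C *ᵥ g) ⬝ᵥ ∑ j, laplacian G i j • x j t)) • B = 0 := by
    have h3 : ∑ i, v i * (k * ((C *ᵥ g) ⬝ᵥ ∑ j, laplacian G i j • x j t))
        = k * ((v ᵥ* laplacian G) ⬝ᵥ fun j => (C *ᵥ g) ⬝ᵥ x j t) := by
      rw [← Matrix.dotProduct_mulVec]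
      simp only [dotProduct_sum, dotProduct_smul, smul_eq_mul]
      rw [dotProduct, Finset.mul_sum]
      exact Finset.sum_congr rfl fun i _ => mul_left_comm _ _ _
    simp only [smul_smul]
    rw [← Finset.sum_smul, h3, hv, zero_dotProduct, mul_zero, zero_smul]
  simp only [smul_sub, Finset.sum_sub_distrib, h2, sub_zero, Matrix.mulVec_sum, Matrix.mulVec_smul]

-- The operator norm only provides the normed algebra structure needed to differentiate the
-- exponential.
attribute [local instance] Matrix.linftyOpNormedRing Matrix.linftyOpNormedAlgebra in
theorem hasDerivAt_exp_smul_mulVec (A : Matrix (Fin n) (Fin n) ℝ) (w : Fin n → ℝ) (t : ℝ) :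
    HasDerivAt (fun t : ℝ => NormedSpace.exp (t • A) *ᵥ w)
      (A *ᵥ (NormedSpace.exp (t • A) *ᵥ w)) t := by
  have h1 : HasDerivAt (fun t : ℝ => NormedSpace.exp (t • A)) (A * NormedSpace.exp (t • A)) t :=
    hasDerivAt_exp_smul_const' A t
  have h2 := (LinearMap.toContinuousLinearMap
    ((Matrix.mulVecBilin ℝ ℝ).flip w : Matrix (Fin n) (Fin n) ℝ →ₗ[ℝ] Fin n → ℝ)).hasFDerivAt
      |>.comp_hasDerivAt t h1
  rw [Matrix.mulVec_mulVec]
  exact h2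

/-- A solution of `z' = A z` on `[0, ∞)` is `exp (A t) z(0)`. -/
theorem eq_exp_smul_mulVec (A : Matrix (Fin n) (Fin n) ℝ) {z : ℝ → Fin n → ℝ}
    (hz : ∀ t, 0 ≤ t → HasDerivWithinAt z (A *ᵥ z t) (Set.Ici 0) t) {t : ℝ} (ht : 0 ≤ t) :
    z t = NormedSpace.exp (t • A) *ᵥ z 0 := by
  have hE := hasDerivAt_exp_smul_mulVec A (z 0)
  have key := ODE_solution_unique_of_mem_Icc_right (a := 0) (b := t)
    (v := fun _ => LinearMap.toContinuousLinearMap A.mulVecLin) (s := fun _ => Set.univ)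
    (fun _ _ => (ContinuousLinearMap.lipschitz _).lipschitzOnWith)
    (f := z) (g := fun t => NormedSpace.exp (t • A) *ᵥ z 0)
    (fun s hs => ((hz s hs.1).mono fun _ h => h.1).continuousWithinAt)
    (fun s hs => (hz s hs.1).mono (Set.Ici_subset_Ici.2 hs.1)) (fun _ _ => trivial)
    (fun s _ => (hE s).continuousAt.continuousWithinAt)
    (fun s _ => (hE s).hasDerivWithinAt) (fun _ _ => trivial) (by simp)
  exact key (Set.right_mem_Icc.2 ht)

/-- The deviations of the agents from their weighted mean tend to zero. -/
theorem IsClosedLoopTrajectory.tendsto_sub_mean (hx : IsClosedLoopTrajectory A B C g G k x)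
    (hA : HyperMinimumPhase A B C g) (hloop : ∀ i, ¬ G.Adj i i) (hG : HasDirectedSpanningTree G)
    (hk : kappa₀ A B C g / minNonzeroRe (laplacian G) < k) (hk0 : 0 < k) {v : Fin N → ℝ}
    (hv : IsNormalizedLeftNull (laplacian G) v) (i : Fin N) :
    Tendsto (fun t => x i t - ∑ j, v j • x j t) atTop (𝓝 0) := by
  obtain ⟨r, hr⟩ := hG.exists_reachable
  set L := laplacian G with hL
  set e : Fin N → ℝ → Fin n → ℝ := fun i t => x i t - ∑ j, v j • x j t with he
  have hsum : ∑ j, v j = 1 := by simpa [dotProduct] using hv.2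
  have hmean : ∀ t, ∑ j, v j • e j t = 0 := fun t => by
    simp only [he, smul_sub, Finset.sum_sub_distrib, ← Finset.sum_smul, hsum, one_smul, sub_self]
  have hLe : ∀ i t, ∑ j, L i j • e j t = ∑ j, L i j • x j t := fun i t => by
    have h0 : ∑ j, L i j = 0 := by
      simpa [Matrix.mulVec, dotProduct] using congrFun (laplacian_mulVec_one G) i
    simp only [he, smul_sub, Finset.sum_sub_distrib, ← Finset.sum_smul, h0, zero_smul, sub_zero]
  have hde : ∀ i t, 0 ≤ t → HasDerivWithinAt (e i)
      (A *ᵥ e i t - (k * ((C *ᵥ g) ⬝ᵥ ∑ j, L i j • e j t)) • B) (Set.Ici 0) t := fun i t ht => by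
    refine ((hx.hasDerivWithinAt i ht).sub (hx.hasDerivWithinAt_mean hv.1 ht)).congr_deriv ?_
    rw [hLe, Matrix.mulVec_sub]
    abel
  -- Complexified generator; its correction term vanishes along e, whose weighted mean is 0.
  set M := errorOperator (A.map Complex.ofReal) (fun a => (B a : ℂ))
    (fun a => ((C *ᵥ g) a : ℂ)) (L.map Complex.ofReal) (fun j => (v j : ℂ)) (k : ℂ) with hM
  have hre : ∀ s : ℂ, M.HasEigenvalue s → s.re < 0 := fun s hs => by
    refine re_neg_of_hasEigenvalue_errorOperator ?_ ?_ ?_ (fun w hw i j => ?_)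
      (fun μ hμ h0 s hs ξ hξ => ?_) hs
    · ext j
      simpa [Matrix.vecMul, dotProduct] using congrArg Complex.ofReal (congrFun hv.1 j)
    · exact_mod_cast congrArg Complex.ofReal hsum
    · ext i
      simpa [Matrix.mulVec, dotProduct] using
        congrArg Complex.ofReal (congrFun (laplacian_mulVec_one G) i)
    · have h1 := eq_of_complex_laplacian_mulVec_eq_zero hr (w := w) fun i => congrFun hw i
      rw [h1 i, h1 j]
    -- The nonzero eigenvalue μ makes r(L) positive, so the gain condition can be cleared of its
    -- denominator; the convention for an empty set of such eigenvalues plays no role here.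
    · have hr0 := minNonzeroRe_laplacian_pos hloop hμ h0
      refine hA.eq_zero_of_eigenvector (c := k * μ) ?_ hs (by rwa [← mul_assoc] at hξ)
      rw [Complex.re_ofReal_mul]
      rw [div_lt_iff₀ hr0] at hk
      exact hk.trans_le (mul_le_mul_of_nonneg_left (minNonzeroRe_le hμ h0) hk0.le)
  have hlim : Tendsto (fun (t : ℝ) (i : Fin N) (a : Fin n) => (e i t a : ℂ)) atTop (𝓝 0) := by
    refine tendsto_zero_of_eigenvalues_re_neg (LinearMap.toContinuousLinearMap M) hre
      fun t ht => ?_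
    refine hasDerivWithinAt_pi.2 fun i => hasDerivWithinAt_pi.2 fun a => ?_
    have h1 := (hasDerivWithinAt_pi.1 (hde i t ht) a).ofReal_comp
    refine h1.congr_deriv ?_
    have hmean' : ∑ j, (v j : ℂ) • (fun a => (e j t a : ℂ)) = 0 := by
      ext a
      simpa using congrArg Complex.ofReal (congrFun (hmean t) a)
    rw [LinearMap.coe_toContinuousLinearMap', hM, errorOperator_apply, hmean', Matrix.mulVec_zero,
      sub_zero, networkAction_apply]
    simp [Matrix.mulVec, dotProduct]
  refine tendsto_pi_nhds.2 fun a => ?_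
  have h1 := tendsto_pi_nhds.1 (tendsto_pi_nhds.1 hlim i) a
  have h2 := (Complex.continuous_re.tendsto _).comp h1
  simp only [Function.comp_def, Complex.ofReal_re] at h2
  exact h2

end Network

end Consensus

end

theorem theorem1 {N n l : ℕ} (A : Matrix (Fin n) (Fin n) ℝ) (B : Fin n → ℝ)
    (C : Matrix (Fin n) (Fin l) ℝ) (g : Fin l → ℝ)
    (hA1 : Consensus.HyperMinimumPhase A B C g)
    (G : Digraph (Fin N)) (hloop : ∀ i, ¬ G.Adj i i)
    (hA2 : Consensus.HasDirectedSpanningTree G) :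
    BddAbove (Set.range (Consensus.negReInv A B C g)) ∧
    (∃! v, Consensus.IsNormalizedLeftNull (Consensus.laplacian G) v) ∧
    ∀ k : ℝ, 0 < k →
      Consensus.kappa₀ A B C g / Consensus.minNonzeroRe (Consensus.laplacian G) < k →
      ∀ x : Fin N → ℝ → Fin n → ℝ, Consensus.IsClosedLoopTrajectory A B C g G k x →
        (∀ i j, Tendsto (fun t => x i t - x j t) atTop (𝓝 0)) ∧
        ∀ v, Consensus.IsNormalizedLeftNull (Consensus.laplacian G) v →
          ∀ i, Tendsto
            (fun t => x i t - Consensus.consensusVector A v (fun j => x j 0) t) atTop (𝓝 0) := by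
  refine ⟨hA1.bddAbove_range_negReInv, Consensus.existsUnique_isNormalizedLeftNull hA2,
    fun k hk0 hk x hx => ⟨fun i j => ?_, fun v hv i => ?_⟩⟩
  · obtain ⟨v, hv, -⟩ := Consensus.existsUnique_isNormalizedLeftNull hA2
    have hlim := hx.tendsto_sub_mean hA1 hloop hA2 hk hk0 hv
    simpa using (hlim i).sub (hlim j)
  -- For t ≥ 0 the weighted mean equals c(t), by uniqueness for z' = Az.
  · refine (hx.tendsto_sub_mean hA1 hloop hA2 hk hk0 hv i).congr' ?_
    filter_upwards [eventually_ge_atTop 0] with t ht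
    rw [Consensus.consensusVector,
      Consensus.eq_exp_smul_mulVec A (fun _ => hx.hasDerivWithinAt_mean hv.1) ht]
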